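/- Let $(\Omega,\mathcal F)$ be a measurable space, $T,M\in\mathbb N$, $(\mathcal F_t)_{t=0}^T$ a filtration with $\mathcal F_t\subset\mathcal F$, and $S=(S_t)_{t=0}^T$ an adapted process with values in $\mathbb R^M_+$. Let $$\mathcal I=\Big\{\sum_{t=1}^T H_t\cdot(S_t-S_{t-1})\;:\;H_t:\Omega\to\mathbb R^M\ \text{is}\ \mathcal F_{t-1}\text{-measurable},\ t=1,\dots,T\Big\}$$ and let $\mathcal I_\ell\subset\mathcal I$ be the set of those gains for which the $H_t$ can be chosen bounded. Put $\hat\ell=\sum_{k=1}^T\sum_{i=1}^M(S^i_k-S^i_0)$, let $c^*>0$ be such that $L^*:=c^*+\hat\ell\ge 1$ on $\Omega$, and let $$\mathcal B_\ell=\{X:\Omega\to\mathbb R\ \ \mathcal F\text{-measurable}:\ |X|\le\alpha L^*\ \text{for some}\ \alpha\ge 0\},\qquad \|X\|_\ell=\inf\{\alpha\ge 0:|X|\le\alpha L^*\}.$$ Let $\mathcal Z$ be a linear space of $\mathcal F$-measurable real functions on $\Omega$ which is a lattice and is closed under pointwise convergence of sequences. Write $X\preceq Y$ if $X\le Y+Z$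 pointwise on $\Omega$ for some $Z\in\mathcal Z$. Assume that $\mathcal Z$ is the class of negligible functions of this preorder (every measurable $X$ with $0\preceq X\preceq 0$ lies in $\mathcal Z$), and that on constants $\preceq$ is the order of $\mathbb R$. Let $\mathcal P=\{X\in\mathcal B_\ell:0\preceq X\}$ and $\mathcal P^+=\{X\in\mathcal P:\text{not } X\preceq 0\}$. For a set $\mathcal J$ of net trades, the market $(\mathcal B_\ell,\|\cdot\|_\ell,\preceq,\mathcal J,\mathcal P^+)$ * has no arbitrage if there are no $\ell\in\mathcal J$, $R\in\mathcal P^+$ with $R\preceq\ell$; * is strongly free of arbitrage if there are no $R\in\mathcal P^+$, $\ell_n\in\mathcal J$, $e_n\in\mathcal P$ with $\|e_n\|_\ell\to0$ and $R\preceq e_n+\ell_n$ for all $n$; * has the attainment property if for every $X\in\mathcal B_\ell$ the super-replication price $$\mathcal D(X)=\inf\{c\in\mathbb R:\ \exists\,\ell_n\in\mathcal J,\ e_n\in\mathcal P,\ \|e_n\|_\ell\to0,\ X\preceq c+e_n+\ell_n\ \text{for all } n\}$$ is finite and $X\preceq\mathcal D(X)+\ell_X$ for some $\ell_X\in\mathcal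 J$. Let $\Theta_*$ be this market with $\mathcal J=\mathcal I$. The following are equivalent: 1. $\Theta_*$ has no arbitrage; 2. $\Theta_*$ has the attainment property and no arbitrage; 3. $\Theta_*$ is strongly free of arbitrage. Moreover, these are equivalent to the absence of arbitrage, and to the strong absence of arbitrage, of the market $(\mathcal B_\ell,\|\cdot\|_\ell,\preceq,\mathcal I_\ell,\mathcal P^+)$ with bounded strategies. -/

import Mathlib

open MeasureTheory Filter Topology

namespace KnightianMarket

/-- The preorder generated by a class `N` of negligible functions:
`X` is below `Y` if `X ≤ Y + Z` pointwise for some `Z` in `N`. -/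
def OrdLE {Ω : Type*} (N : Submodule ℝ (Ω → ℝ)) (X Y : Ω → ℝ) : Prop :=
  ∃ Z ∈ N, ∀ ω, X ω ≤ Y ω + Z ω

/-- The standing assumptions on the class of negligible functions (a linear space of measurable
functions): it is a lattice, it is closed under pointwise convergence of sequences, it contains
every measurable function that is equivalent to `0` for the preorder it generates (so it is the
class of negligible functions of that preorder), and on constants that preorder is the order
of the reals. -/
structure IsNegligibleClass {Ω : Type*} [MeasurableSpace Ω] (N : Submodule ℝ (Ω → ℝ)) : Prop where
  measurable : ∀ Z ∈ N, Measurable Z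
  sup_mem : ∀ Y ∈ N, ∀ Z ∈ N, (fun ω => max (Y ω) (Z ω)) ∈ N
  inf_mem : ∀ Y ∈ N, ∀ Z ∈ N, (fun ω => min (Y ω) (Z ω)) ∈ N
  lim_mem : ∀ (z : ℕ → Ω → ℝ) (Z : Ω → ℝ), (∀ n, z n ∈ N) →
    (∀ ω, Tendsto (fun n => z n ω) atTop (𝓝 (Z ω))) → Z ∈ N
  mem_of_equiv_zero : ∀ X : Ω → ℝ, Measurable X → OrdLE N 0 X → OrdLE N X 0 → X ∈ N
  const_le : ∀ a b : ℝ, OrdLE N (fun _ => a) (fun _ => b) → a ≤ b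

/-- The data of a financial market on `Ω`: the space of claims, its norm, the common preorder
(on real functions on `Ω`), the net trades and the relevant claims. -/
structure Market (Ω : Type*) where
  /-- the space of contingent claims -/
  claims : Set (Ω → ℝ)
  /-- the norm that induces the topology of the space of claims -/
  size : (Ω → ℝ) → ℝ
  /-- the common preorder -/
  le : (Ω → ℝ) → (Ω → ℝ) → Prop
  /-- the payoffs attainable from zero initial wealth -/
  trades : Set (Ω → ℝ)
  /-- the relevant claims -/
  relevant : Set (Ω → ℝ)

namespace Market

variable {Ω : Type*}

/-- The net trade `l` is an arbitrage. -/
def IsArbitrage (Θ : Market Ω) (l : Ω → ℝ) : Prop :=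
  l ∈ Θ.trades ∧ ∃ R ∈ Θ.relevant, Θ.le R l

/-- The market has no arbitrages. -/
def NoArbitrage (Θ : Market Ω) : Prop :=
  ∀ l, ¬ Θ.IsArbitrage l

/-- A vanishing sequence of nonnegative claims. -/
def IsVanishing (Θ : Market Ω) (e : ℕ → Ω → ℝ) : Prop :=
  (∀ n, e n ∈ Θ.claims) ∧ (∀ n, Θ.le 0 (e n)) ∧ Tendsto (fun n => Θ.size (e n)) atTop (𝓝 0)

/-- The sequence of net trades `l` is a free lunch with vanishing risk. -/
def IsFreeLunch (Θ : Market Ω) (l : ℕ → Ω → ℝ) : Prop :=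
  (∀ n, l n ∈ Θ.trades) ∧
    ∃ R ∈ Θ.relevant, ∃ e : ℕ → Ω → ℝ, Θ.IsVanishing e ∧
      ∀ n, Θ.le R (fun ω => e n ω + l n ω)

/-- There is no free lunch with vanishing risk. -/
def StronglyFreeOfArbitrage (Θ : Market Ω) : Prop :=
  ∀ l, ¬ Θ.IsFreeLunch l

/-- The initial capital `c` super-replicates `X` up to a vanishing sequence. -/
def SuperReplicates (Θ : Market Ω) (c : ℝ) (X : Ω → ℝ) : Prop :=
  ∃ l e : ℕ → Ω → ℝ, (∀ n, l n ∈ Θ.trades) ∧ Θ.IsVanishing e ∧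
    ∀ n, Θ.le X (fun ω => c + e n ω + l n ω)

/-- The super-replication functional, with values in the extended reals (`⊤` if no capital
super-replicates). -/
noncomputable def superRep (Θ : Market Ω) (X : Ω → ℝ) : EReal :=
  sInf {x : EReal | ∃ c : ℝ, x = (c : EReal) ∧ Θ.SuperReplicates c X}

/-- The attainment property: for every claim the super-replication price is finite and is
the capital of an exact super-replication by one net trade. -/
def Attainment (Θ : Market Ω) : Prop :=
  ∀ X ∈ Θ.claims, ∃ d : ℝ, Θ.superRep X = (d : EReal) ∧
    ∃ l ∈ Θ.trades, Θ.le X (fun ω => d + l ω)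

end Market

section DiscreteTime

variable {Ω : Type*} [m : MeasurableSpace Ω] {M : ℕ}

/-- `H` is predictable up to the horizon `T`: for `1 ≤ t ≤ T`, the vector `H t` is measurable
with respect to the sigma-field at time `t - 1`. -/
def IsPredictable (𝓕 : Filtration ℕ m) (T : ℕ) (H : ℕ → Ω → Fin M → ℝ) : Prop :=
  ∀ t < T, Measurable[𝓕 t] (H (t + 1))

/-- The terminal gain `∑ t = 1, …, T` of `H t · (S t - S (t - 1))`. -/
def gains (S : ℕ → Ω → Fin M → ℝ) (T : ℕ) (H : ℕ → Ω → Fin M → ℝ) (ω : Ω) : ℝ :=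
  ∑ t ∈ Finset.range T, ∑ i, H (t + 1) ω i * (S (t + 1) ω i - S t ω i)

/-- The terminal gains of all predictable strategies. -/
def netTrades (𝓕 : Filtration ℕ m) (S : ℕ → Ω → Fin M → ℝ) (T : ℕ) : Set (Ω → ℝ) :=
  {l | ∃ H : ℕ → Ω → Fin M → ℝ, IsPredictable 𝓕 T H ∧ l = gains S T H}

/-- The terminal gains of the bounded predictable strategies. -/
def boundedNetTrades (𝓕 : Filtration ℕ m) (S : ℕ → Ω → Fin M → ℝ) (T : ℕ) : Set (Ω → ℝ) :=
  {l | ∃ H : ℕ → Ω → Fin M → ℝ, IsPredictable 𝓕 T H ∧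
    (∃ C : ℝ, ∀ t < T, ∀ ω i, |H (t + 1) ω i| ≤ C) ∧ l = gains S T H}

/-- The weight `c + ∑ (S k i - S 0 i)`, the sum over the times `k = 1, …, T` and the assets `i`. -/
def weight (S : ℕ → Ω → Fin M → ℝ) (T : ℕ) (c : ℝ) (ω : Ω) : ℝ :=
  c + ∑ k ∈ Finset.Icc 1 T, ∑ i, (S k ω i - S 0 ω i)

/-- The measurable functions that are dominated by a multiple of the weight `L`. -/
def growthSpace (L : Ω → ℝ) : Set (Ω → ℝ) :=
  {X | Measurable X ∧ ∃ a : ℝ, 0 ≤ a ∧ ∀ ω, |X ω| ≤ a * L ω}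

/-- The weighted supremum norm of `growthSpace L`. -/
noncomputable def growthNorm (L X : Ω → ℝ) : ℝ :=
  sInf {a : ℝ | 0 ≤ a ∧ ∀ ω, |X ω| ≤ a * L ω}

/-- The market on the claims dominated by the weight `L`, with the preorder generated by `N`,
the net trades `I` and all positive claims as relevant claims. -/
noncomputable def growthMarket (L : Ω → ℝ) (N : Submodule ℝ (Ω → ℝ)) (I : Set (Ω → ℝ)) :
    Market Ω where
  claims := growthSpace L
  size := growthNorm L
  le := OrdLE N
  trades := I
  relevant := {R | R ∈ growthSpace L ∧ OrdLE N 0 R ∧ ¬ OrdLE N R 0}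

end DiscreteTime

end KnightianMarket

/-! The supports of negligible functions generate a σ-ideal, so for measurable functions the
preorder is an almost-everywhere order along a filter with countable intersections, and the
classical probability-free arguments apply. The heart is Fatou closedness: without arbitrage, the
claims dominated by a net trade are closed under pointwise sequential convergence outside a
negligible support (`isFatouClosed_netTrades`).

It is proved by adding one scalar increment at a time (`IsFatouClosed.insert_increment`). Along a
random subsequence the positions either converge, and one passes to the limit, or tend to infinity
in absolute value. In the second case, dividing by their size yields a nonnegative gain; absence of
arbitrage makes it negligible, so the increment is redundant there and is replaced by the other
trades.

Closedness turns approximate super-replication into exact super-replication, hence gives strong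
absence of arbitrage and attainment. The bounded market inherits strong absence of arbitrage because
it has fewer trades. Conversely, a multi-period arbitrage produces a one-period one, whose positions
can be scaled to be bounded without changing the sign of the gain. -/

namespace KnightianMarket

/-! ### The almost-everywhere order defined by the negligible functions -/

section NegligibleFilter

variable {Ω : Type*} [m : MeasurableSpace Ω] {N : Submodule ℝ (Ω → ℝ)}

/-- A measurable function supported in the support of a negligible function is negligible. -/
theorem IsNegligibleClass.mem_of_support (hN : IsNegligibleClass N) {X Z : Ω → ℝ} (hZ : Z ∈ N)
    (hX : Measurable X) (h : ∀ ω, X ω ≠ 0 → Z ω ≠ 0) : X ∈ N := by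
  have hZm := hN.measurable Z hZ
  have habs : (fun ω => |Z ω|) ∈ N := by
    have := hN.sup_mem Z hZ (-Z) (N.neg_mem hZ)
    exact this
  have hmul : ∀ n : ℕ, (fun ω => (n : ℝ) * |Z ω|) ∈ N := fun n => N.smul_mem (n : ℝ) habs
  -- Truncate `X` at the levels `±n|Z|`: each truncation is equivalent to zero, and at each point it
  -- eventually equals `X`.
  refine hN.lim_mem (fun n ω => max (-((n : ℝ) * |Z ω|)) (min (X ω) ((n : ℝ) * |Z ω|))) X ?_ ?_
  · intro n
    have hnm : Measurable fun ω => (n : ℝ) * |Z ω| := hN.measurable _ (hmul n)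
    refine hN.mem_of_equiv_zero _ (hnm.neg.max (hX.min hnm)) ⟨_, hmul n, fun ω => ?_⟩
      ⟨_, hmul n, fun ω => ?_⟩
    · have := le_max_left (-((n : ℝ) * |Z ω|)) (min (X ω) ((n : ℝ) * |Z ω|))
      simp only [Pi.zero_apply]
      linarith
    · have h0 : 0 ≤ (n : ℝ) * |Z ω| := by positivity
      simp only [Pi.zero_apply, zero_add]
      exact max_le (by linarith) (min_le_right _ _)
  · intro ω
    obtain ⟨k, hk⟩ : ∃ k : ℕ, |X ω| ≤ k * |Z ω| := by
      by_cases hx : X ω = 0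
      · exact ⟨0, by simp [hx]⟩
      · have hz : 0 < |Z ω| := abs_pos.mpr (h ω hx)
        obtain ⟨k, hk⟩ := exists_nat_ge (|X ω| / |Z ω|)
        exact ⟨k, (div_le_iff₀ hz).mp hk⟩
    refine tendsto_const_nhds.congr' ?_
    filter_upwards [eventually_ge_atTop k] with n hn
    have hle : |X ω| ≤ n * |Z ω| :=
      hk.trans (mul_le_mul_of_nonneg_right (by exact_mod_cast hn) (abs_nonneg _))
    obtain ⟨h1, h2⟩ := abs_le.mp hle
    rw [min_eq_left h2, max_eq_right h1]

/-- Countably many supports of negligible functions lie in one such support. -/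
theorem IsNegligibleClass.exists_support (hN : IsNegligibleClass N) (z : ℕ → Ω → ℝ)
    (hz : ∀ n, z n ∈ N) : ∃ Z ∈ N, ∀ n ω, z n ω ≠ 0 → Z ω ≠ 0 := by
  classical
  have hzm : ∀ n, MeasurableSet {ω | z n ω ≠ 0} := fun n =>
    (hN.measurable _ (hz n) (measurableSet_singleton 0)).compl
  have habs : ∀ n, (fun ω => |z n ω|) ∈ N := fun n =>
    hN.mem_of_support (hz n) (hN.measurable _ (hz n)).abs fun ω => abs_ne_zero.mp
  refine ⟨fun ω => if ∃ k, z k ω ≠ 0 then 1 else 0, ?_, fun n ω h => ?_⟩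
  -- The indicator of the countable union is the limit of the indicators of finite unions, each
  -- supported where a finite sum of the `|z k|` is nonzero.
  · refine hN.lim_mem (fun n ω => if ∃ k < n, z k ω ≠ 0 then 1 else 0) _ (fun n => ?_) fun ω => ?_
    · refine hN.mem_of_support (Z := ∑ k ∈ Finset.range n, fun ω => |z k ω|)
        (N.sum_mem fun k _ => habs k) ?_ fun ω h => ?_
      · refine Measurable.ite ?_ measurable_const measurable_const
        have : {ω | ∃ k < n, z k ω ≠ 0} = ⋃ k, ⋃ (_ : k < n), {ω | z k ω ≠ 0} := by
          ext ω; simp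
        rw [this]
        exact MeasurableSet.iUnion fun k => MeasurableSet.iUnion fun _ => hzm k
      · have hex : ∃ k < n, z k ω ≠ 0 := by
          by_contra hc
          exact h (if_neg hc)
        obtain ⟨k, hk, hne⟩ := hex
        rw [Finset.sum_apply]
        refine (Finset.sum_pos' (fun _ _ => abs_nonneg _)
          ⟨k, Finset.mem_range.mpr hk, abs_pos.mpr hne⟩).ne'
    · refine tendsto_const_nhds.congr' ?_
      by_cases h : ∃ k, z k ω ≠ 0
      · obtain ⟨k, hk⟩ := h
        filter_upwards [eventually_gt_atTop k] with n hn
        rw [if_pos ⟨k, hk⟩, if_pos ⟨k, hn, hk⟩]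
      · refine Eventually.of_forall fun n => ?_
        simp only
        rw [if_neg h, if_neg fun ⟨k, _, hk⟩ => h ⟨k, hk⟩]
  · have : ∃ k, z k ω ≠ 0 := ⟨n, h⟩
    simp [this]

/-- The filter of the sets whose complement is contained in the support of a negligible
function. -/
def negligibleFilter (hN : IsNegligibleClass N) : Filter Ω :=
  Filter.ofCountableUnion {s | ∃ Z ∈ N, ∀ ω ∈ s, Z ω ≠ 0}
    (by
      intro 𝒮 h𝒮 hsub
      rcases 𝒮.eq_empty_or_nonempty with rfl | hne
      · exact ⟨0, N.zero_mem, by simp⟩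
      obtain ⟨s, rfl⟩ := h𝒮.exists_eq_range hne
      have : ∀ n, ∃ Z ∈ N, ∀ ω ∈ s n, Z ω ≠ 0 := fun n =>
        hsub _ (Set.mem_range_self n)
      choose z hz hzs using this
      obtain ⟨Z, hZ, h⟩ := hN.exists_support z hz
      refine ⟨Z, hZ, ?_⟩
      rintro ω ⟨_, ⟨n, rfl⟩, hω⟩
      exact h n ω (hzs n ω hω))
    (by
      rintro t ⟨Z, hZ, h⟩ s hst
      exact ⟨Z, hZ, fun ω hω => h ω (hst hω)⟩)

instance (hN : IsNegligibleClass N) : CountableInterFilter (negligibleFilter hN) := by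
  unfold negligibleFilter
  infer_instance

theorem eventually_negligibleFilter (hN : IsNegligibleClass N) {p : Ω → Prop} :
    (∀ᶠ ω in negligibleFilter hN, p ω) ↔ ∃ Z ∈ N, ∀ ω, ¬ p ω → Z ω ≠ 0 :=
  Iff.rfl

theorem OrdLE.eventuallyLE (hN : IsNegligibleClass N) {X Y : Ω → ℝ} (h : OrdLE N X Y) :
    X ≤ᶠ[negligibleFilter hN] Y := by
  obtain ⟨Z, hZ, h⟩ := h
  refine (eventually_negligibleFilter hN).mpr ⟨Z, hZ, fun ω hω h0 => hω ?_⟩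
  simpa [h0] using h ω

/-- The error term is the positive part of `X - Y`; measurability is what makes it negligible. -/
theorem ordLE_of_eventuallyLE (hN : IsNegligibleClass N) {X Y : Ω → ℝ} (hX : Measurable X)
    (hY : Measurable Y) (h : X ≤ᶠ[negligibleFilter hN] Y) : OrdLE N X Y := by
  obtain ⟨Z, hZ, h⟩ := (eventually_negligibleFilter hN).mp h
  refine ⟨fun ω => max (X ω - Y ω) 0, hN.mem_of_support hZ ((hX.sub hY).max measurable_const)
    fun ω hω => h ω fun hle => hω (max_eq_right (sub_nonpos.mpr hle)), fun ω => ?_⟩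
  have := le_max_left (X ω - Y ω) 0
  simp only
  linarith

theorem not_one_ordLE_zero (hN : IsNegligibleClass N) : ¬ OrdLE N (fun _ => 1) 0 := fun h =>
  absurd (hN.const_le 1 0 h) (by norm_num)

end NegligibleFilter

/-! ### Closedness of the dominated claims under sequential convergence -/

section FatouClosed

variable {Ω : Type*}

/-- The claims dominated by an element of `I` are closed under sequential convergence along the
filter `F`. -/
def IsFatouClosed (F : Filter Ω) (I : Set (Ω → ℝ)) : Prop :=
  ∀ (W g : ℕ → Ω → ℝ) (V : Ω → ℝ), (∀ n, g n ∈ I) → (∀ n, W n ≤ᶠ[F] g n) →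
    (∀ᶠ ω in F, Tendsto (fun n => W n ω) atTop (𝓝 (V ω))) → ∃ l ∈ I, V ≤ᶠ[F] l

/-- A bounded sequence of measurable functions has a measurably indexed pointwise convergent
subsequence. -/
theorem exists_measurable_subseq [G : MeasurableSpace Ω] (y : ℕ → Ω → ℝ)
    (hy : ∀ n, Measurable (y n)) (hb : ∀ n ω, |y n ω| ≤ 1) :
    ∃ L : Ω → ℝ, Measurable L ∧ ∃ σ : ℕ → Ω → ℕ, (∀ k, Measurable (σ k)) ∧
      (∀ k ω, k ≤ σ k ω) ∧ ∀ ω, Tendsto (fun k => y (σ k ω) ω) atTop (𝓝 (L ω)) := by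
  classical
  -- The liminf is a measurable cluster point. Taking the first index `≥ k` within `1 / (k + 1)` of
  -- it keeps the choice measurable.
  set L : Ω → ℝ := fun ω => liminf (fun n => y n ω) atTop with hLdef
  have hL : Measurable L := Measurable.liminf hy
  have hex : ∀ (k : ℕ) ω, ∃ n, k ≤ n ∧ |y n ω - L ω| < 1 / ((k : ℝ) + 1) := by
    intro k ω
    have hpos : (0 : ℝ) < 1 / ((k : ℝ) + 1) := by positivity
    have hbb : IsBoundedUnder (· ≥ ·) atTop (fun n => y n ω) :=
      isBoundedUnder_of ⟨-1, fun n => (abs_le.mp (hb n ω)).1⟩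
    have hba : IsBoundedUnder (· ≤ ·) atTop (fun n => y n ω) :=
      isBoundedUnder_of ⟨1, fun n => (abs_le.mp (hb n ω)).2⟩
    have h1 : ∃ᶠ n in atTop, y n ω < L ω + 1 / ((k : ℝ) + 1) :=
      frequently_lt_of_liminf_lt hba.isCoboundedUnder_ge (by simp only [hLdef]; linarith)
    have h2 : ∀ᶠ n in atTop, L ω - 1 / ((k : ℝ) + 1) < y n ω :=
      eventually_lt_of_lt_liminf (by simp only [hLdef]; linarith) hbb
    obtain ⟨n, h1, h2, h3⟩ := (h1.and_eventually (h2.and (eventually_ge_atTop k))).exists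
    exact ⟨n, h3, abs_lt.mpr ⟨by linarith, by linarith⟩⟩
  refine ⟨L, hL, fun k ω => Nat.find (hex k ω), fun k => ?_, fun k ω => ?_, fun ω => ?_⟩
  · refine measurable_find (hex k) fun n => ?_
    exact (MeasurableSet.const _).inter
      (measurableSet_lt ((hy n).sub hL).abs measurable_const)
  · exact (Nat.find_spec (hex k ω)).1
  · rw [tendsto_iff_dist_tendsto_zero]
    refine squeeze_zero (fun _ => dist_nonneg) (fun k => ?_) tendsto_one_div_add_atTop_nhds_zero_nat
    rw [Real.dist_eq]
    exact (Nat.find_spec (hex k ω)).2.le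

theorem measurable_apply_nat [G : MeasurableSpace Ω] {h : ℕ → Ω → ℝ} (hh : ∀ n, Measurable (h n))
    {σ : Ω → ℕ} (hσ : Measurable σ) : Measurable fun ω => h (σ ω) ω :=
  (measurable_from_prod_countable_right (f := fun p : ℕ × Ω => h p.1 p.2) hh).comp
    (hσ.prodMk measurable_id)

/-- Fatou closedness is preserved when one traded increment `D`, with `G`-measurable positions,
is added, provided that the enlarged set of trades admits no arbitrage. -/
theorem IsFatouClosed.insert_increment [G : MeasurableSpace Ω] {F : Filter Ω}
    [CountableInterFilter F] {I I' : Set (Ω → ℝ)} {D : Ω → ℝ}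
    (hI' : ∀ g, g ∈ I' ↔ ∃ h : Ω → ℝ, Measurable h ∧ ∃ k ∈ I, g = fun ω => h ω * D ω + k ω)
    (hsub : ∀ g ∈ I, ∀ k ∈ I, (fun ω => g ω - k ω) ∈ I)
    (hmul : ∀ φ : Ω → ℝ, Measurable φ → ∀ g ∈ I, (fun ω => φ ω * g ω) ∈ I)
    (hglue : ∀ σ : Ω → ℕ, Measurable σ → ∀ g : ℕ → Ω → ℝ, (∀ n, g n ∈ I) →
      (fun ω => g (σ ω) ω) ∈ I)
    (hna : ∀ g ∈ I', 0 ≤ᶠ[F] g → g ≤ᶠ[F] 0) (hI : IsFatouClosed F I) : IsFatouClosed F I' := by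
  classical
  intro W g V hg hWg hWV
  choose h₀ hh₀ k₀ hk₀ hgeq using fun n => (hI' (g n)).mp (hg n)
  -- The map `x ↦ x / (1 + |x|)` compactifies the line, so limits of positions always exist; `|L| =
  -- 1` corresponds to positions tending to infinity in absolute value.
  obtain ⟨L, hL, σ, hσ, hσk, hσL⟩ := exists_measurable_subseq (fun n ω => h₀ n ω / (1 + |h₀ n ω|))
    (fun n => (hh₀ n).div (measurable_const.add (hh₀ n).abs)) (fun n ω => by
      rw [abs_div, abs_of_pos (by positivity : 0 < 1 + |h₀ n ω|), div_le_one (by positivity)]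
      linarith)
  set h : ℕ → Ω → ℝ := fun n ω => h₀ (σ n ω) ω with hhdef
  set k : ℕ → Ω → ℝ := fun n ω => k₀ (σ n ω) ω with hkdef
  set y : ℕ → Ω → ℝ := fun n ω => h n ω / (1 + |h n ω|) with hydef
  have hh : ∀ n, Measurable (h n) := fun n => measurable_apply_nat hh₀ (hσ n)
  have hk : ∀ n, k n ∈ I := fun n => hglue _ (hσ n) _ hk₀
  have hyL : ∀ ω, Tendsto (fun n => y n ω) atTop (𝓝 (L ω)) := hσL
  have hWk : ∀ᶠ ω in F, ∀ n, W (σ n ω) ω ≤ h n ω * D ω + k n ω := by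
    filter_upwards [eventually_countable_forall.mpr hWg] with ω hω n
    have := hω (σ n ω)
    rwa [hgeq] at this
  have hWσ : ∀ᶠ ω in F, Tendsto (fun n => W (σ n ω) ω) atTop (𝓝 (V ω)) := by
    filter_upwards [hWV] with ω hω
    exact hω.comp (tendsto_atTop_mono (fun n => hσk n ω) tendsto_id)
  have hrpos : ∀ n ω, 0 < 1 + |h n ω| := fun n ω => by positivity
  have hr : ∀ n ω, 1 - |y n ω| = 1 / (1 + |h n ω|) := fun n ω => by
    rw [hydef]
    simp only
    rw [abs_div, abs_of_pos (hrpos n ω)]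
    have := (hrpos n ω).ne'
    field_simp
    ring
  set b : Ω → ℝ := fun ω => if |L ω| = 1 then 1 else 0 with hbdef
  have hbm : Measurable b :=
    Measurable.ite (hL.abs (measurableSet_singleton 1)) measurable_const measurable_const
  -- Divide the domination by `1 + |h|` on `{|L| = 1}`. The term in `W` vanishes in the limit, so
  -- closedness of `I` gives `q` with `-(L * D) ≤ q` there.
  obtain ⟨q, hq, hqle⟩ := hI
    (fun n ω => b ω * ((1 - |y n ω|) * W (σ n ω) ω - y n ω * D ω))
    (fun n ω => (b ω * (1 / (1 + |h n ω|))) * k n ω) (fun ω => b ω * -(L ω * D ω))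
    (fun n => hmul _ (hbm.mul (measurable_const.div (measurable_const.add (hh n).abs))) _ (hk n))
    (fun n => by
      filter_upwards [hWk] with ω hω
      have hb0 : 0 ≤ b ω := by simp only [hbdef]; split_ifs <;> norm_num
      rw [mul_assoc]
      refine mul_le_mul_of_nonneg_left ?_ hb0
      rw [hr, show y n ω = 1 / (1 + |h n ω|) * h n ω by simp only [hydef]; ring]
      have := mul_le_mul_of_nonneg_left (hω n) (one_div_pos.mpr (hrpos n ω)).le
      linarith)
    (by
      filter_upwards [hWσ] with ω hω
      have := ((((hyL ω).abs.const_sub 1).mul hω).sub ((hyL ω).mul_const (D ω))).const_mul (b ω)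
      convert this using 2
      simp only [hbdef]
      split_ifs with hc
      · rw [hc]; ring
      · ring)
  -- The gain `b * (L * D + q)` is nonnegative, hence negligible. As `L² = 1` on that set, `D = -(L
  -- * q)`: the new increment is redundant there.
  have hqD : ∀ᶠ ω in F, |L ω| = 1 → L ω * D ω + q ω = 0 := by
    have hnn : (0 : Ω → ℝ) ≤ᶠ[F] fun ω => (b ω * L ω) * D ω + b ω * q ω := by
      filter_upwards [hqle] with ω hω
      simp only [hbdef, Pi.zero_apply] at hω ⊢
      split_ifs at hω ⊢ <;> linarith
    have hnp := hna _ ((hI' _).mpr ⟨_, hbm.mul hL, _, hmul b hbm q hq, rfl⟩) hnn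
    filter_upwards [hnn, hnp] with ω h1 h2 hc
    simp only [Pi.mul_apply, hbdef, hc, Pi.zero_apply, if_true] at h1 h2
    linarith
  -- On `{|L| = 1}` trade `-(h * L * q)` in place of `h * D`; elsewhere `h` converges to `L / (1 -
  -- |L|)`. The factor `1 - b` removes the quotient where its denominator is zero.
  obtain ⟨l, hl, hVl⟩ := hI
    (fun n ω => W (σ n ω) ω - (1 - b ω) * h n ω * D ω)
    (fun n ω => k n ω - (b ω * h n ω * L ω) * q ω)
    (fun ω => V ω - (1 - b ω) * (L ω / (1 - |L ω|)) * D ω)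
    (fun n => hsub _ (hk n) _ (hmul _ ((hbm.mul (hh n)).mul hL) _ hq))
    (fun n => by
      filter_upwards [hWk, hqD] with ω hω hc
      have h1 := hω n
      simp only [hbdef]
      split_ifs with hL1
      · have hsq : L ω * L ω = 1 := by rw [← abs_mul_abs_self, hL1, one_mul]
        have hq' : q ω = -(L ω * D ω) := by linarith [hc hL1]
        have : h n ω * L ω * q ω = -(h n ω * D ω) := by
          rw [hq']
          linear_combination (-(h n ω * D ω)) * hsq
        linarith
      · linarith)
    (by
      filter_upwards [hWσ] with ω hω
      by_cases hL1 : |L ω| = 1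
      · simpa [hbdef, hL1] using hω
      · have hlim : Tendsto (fun n => h n ω) atTop (𝓝 (L ω / (1 - |L ω|))) := by
          have := (hyL ω).div ((hyL ω).abs.const_sub 1) (sub_ne_zero.mpr (Ne.symm hL1))
          refine this.congr fun n => ?_
          rw [Pi.div_apply, hr]
          simp only [hydef]
          have := (hrpos n ω).ne'
          field_simp
        exact hω.sub ((hlim.const_mul _).mul_const _))
  refine ⟨fun ω => ((1 - b ω) * (L ω / (1 - |L ω|))) * D ω + l ω, (hI' _).mpr
    ⟨_, (measurable_const.sub hbm).mul (hL.div (measurable_const.sub hL.abs)), l, hl, rfl⟩, ?_⟩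
  filter_upwards [hVl] with ω hω
  linarith

/-- The gains from positions in the increments `D p`, `p ∈ A`, held from the time `τ p` on. -/
def scalarTrades {ι : Type*} {m : MeasurableSpace Ω} (𝓕 : Filtration ℕ m) (τ : ι → ℕ)
    (D : ι → Ω → ℝ) (A : Finset ι) : Set (Ω → ℝ) :=
  {g | ∃ h : ι → Ω → ℝ, (∀ p ∈ A, Measurable[𝓕 (τ p)] (h p)) ∧
    g = fun ω => ∑ p ∈ A, h p ω * D p ω}

/-- Increments are inserted backwards in time: the new one has the smallest `τ`, so multipliers and
random indices measurable at its time are admissible for all positions already present. -/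
theorem isFatouClosed_scalarTrades {ι : Type*} [DecidableEq ι] {m : MeasurableSpace Ω}
    {F : Filter Ω} [CountableInterFilter F] (𝓕 : Filtration ℕ m) (τ : ι → ℕ) (D : ι → Ω → ℝ)
    (A : Finset ι)
    (hna : ∀ g ∈ scalarTrades 𝓕 τ D A, 0 ≤ᶠ[F] g → g ≤ᶠ[F] 0) :
    IsFatouClosed F (scalarTrades 𝓕 τ D A) := by
  induction A using Finset.induction_on_min_value τ with
  | empty =>
    intro W g V hg hWg hWV
    refine ⟨0, ⟨0, by simp, by ext; simp⟩, ?_⟩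
    have hg0 : ∀ n ω, g n ω = 0 := fun n ω => by
      obtain ⟨h, -, hh⟩ := hg n
      rw [hh]; simp
    filter_upwards [hWV, eventually_countable_forall.mpr hWg] with ω h1 h2
    exact le_of_tendsto' h1 fun n => (h2 n).trans_eq (hg0 n ω)
  | insert a A haA hmin ih =>
    have hI' : ∀ g, g ∈ scalarTrades 𝓕 τ D (insert a A) ↔ ∃ h : Ω → ℝ, Measurable[𝓕 (τ a)] h ∧
        ∃ k ∈ scalarTrades 𝓕 τ D A, g = fun ω => h ω * D a ω + k ω := by
      intro g
      constructor
      · rintro ⟨h, hh, rfl⟩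
        refine ⟨h a, hh a (Finset.mem_insert_self _ _), _,
          ⟨h, fun p hp => hh p (Finset.mem_insert_of_mem hp), rfl⟩, ?_⟩
        ext ω
        rw [Finset.sum_insert haA]
      · rintro ⟨h, hh, _, ⟨k, hk, rfl⟩, rfl⟩
        have hne : ∀ p ∈ A, p ≠ a := fun p hp hpa => haA (hpa ▸ hp)
        refine ⟨Function.update k a h, fun p hp => ?_, ?_⟩
        · rcases Finset.mem_insert.mp hp with rfl | hp
          · rwa [Function.update_self]
          · rw [Function.update_of_ne (hne p hp)]
            exact hk p hp
        · ext ω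
          rw [Finset.sum_insert haA, Function.update_self]
          congr 1
          exact Finset.sum_congr rfl fun p hp => by rw [Function.update_of_ne (hne p hp)]
    refine IsFatouClosed.insert_increment (G := 𝓕 (τ a)) hI' ?_ ?_ ?_ hna (ih fun g hg => ?_)
    · rintro _ ⟨h, hh, rfl⟩ _ ⟨k, hk, rfl⟩
      refine ⟨fun p ω => h p ω - k p ω, fun p hp => (hh p hp).sub (hk p hp), ?_⟩
      ext ω
      rw [← Finset.sum_sub_distrib]
      exact Finset.sum_congr rfl fun p _ => by ring
    · rintro φ hφ _ ⟨h, hh, rfl⟩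
      refine ⟨fun p ω => φ ω * h p ω,
        fun p hp => (hφ.mono (𝓕.mono (hmin p hp)) le_rfl).mul (hh p hp), ?_⟩
      ext ω
      rw [Finset.mul_sum]
      exact Finset.sum_congr rfl fun p _ => by ring
    · intro σ hσ g hg
      choose h hh hgeq using hg
      refine ⟨fun p ω => h (σ ω) p ω, fun p hp => measurable_apply_nat (G := 𝓕 (τ p))
        (fun n => hh n p hp) (hσ.mono (𝓕.mono (hmin p hp)) le_rfl), ?_⟩
      ext ω
      rw [hgeq]
    · exact hna g ((hI' g).mpr ⟨0, measurable_const, g, hg, by ext; simp⟩)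

end FatouClosed

/-! ### From Fatou closedness to strong absence of arbitrage and attainment -/

section GrowthMarket

theorem growthNorm_zero {Ω : Type*} (L : Ω → ℝ) : growthNorm L (fun _ => 0) = 0 :=
  le_antisymm (csInf_le ⟨0, fun _ h => h.1⟩ ⟨le_rfl, by simp⟩) (Real.sInf_nonneg fun _ h => h.1)

variable {Ω : Type*} [m : MeasurableSpace Ω] {N : Submodule ℝ (Ω → ℝ)} {L : Ω → ℝ}
  {I : Set (Ω → ℝ)}

theorem abs_le_growthNorm_mul {X : Ω → ℝ} (hX : X ∈ growthSpace L) (hL : ∀ ω, 1 ≤ L ω) (ω : Ω) :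
    |X ω| ≤ growthNorm L X * L ω := by
  obtain ⟨-, a, ha, hXa⟩ := hX
  have hpos : 0 < L ω := one_pos.trans_le (hL ω)
  rw [← div_le_iff₀ hpos]
  exact le_csInf ⟨a, ha, hXa⟩ fun b hb => (div_le_iff₀ hpos).mpr (hb.2 ω)

theorem isVanishing_zero (L : Ω → ℝ) (N : Submodule ℝ (Ω → ℝ)) (I : Set (Ω → ℝ)) :
    (growthMarket L N I).IsVanishing fun _ _ => 0 :=
  ⟨fun _ => ⟨measurable_const, 0, le_rfl, by simp⟩, fun _ => ⟨0, N.zero_mem, by simp⟩, by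
    simp only [growthMarket, growthNorm_zero]
    exact tendsto_const_nhds⟩

theorem tendsto_of_isVanishing (hL : ∀ ω, 1 ≤ L ω) {e : ℕ → Ω → ℝ}
    (he : (growthMarket L N I).IsVanishing e) (ω : Ω) :
    Tendsto (fun n => e n ω) atTop (𝓝 0) := by
  have h : Tendsto (fun n => growthNorm L (e n) * L ω) atTop (𝓝 0) := by
    simpa using (show Tendsto (fun n => growthNorm L (e n)) atTop (𝓝 0) from he.2.2).mul_const (L ω)
  exact squeeze_zero_norm (fun n => abs_le_growthNorm_mul (he.1 n) hL ω) h

/-- Absence of arbitrage in terms of the net trades only. -/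
theorem noArbitrage_iff (hN : IsNegligibleClass N) (hL : ∀ ω, 1 ≤ L ω)
    (hI : ∀ l ∈ I, Measurable l) : (growthMarket L N I).NoArbitrage ↔
      ∀ l ∈ I, 0 ≤ᶠ[negligibleFilter hN] l → l ≤ᶠ[negligibleFilter hN] 0 := by
  constructor
  · intro h l hl h0
    by_contra hne
    -- The gain itself may exceed every multiple of `L`; its truncation at `1` is a claim because `1
    -- ≤ L`.
    have hRm : Measurable fun ω => max 0 (min (l ω) 1) :=
      measurable_const.max ((hI l hl).min measurable_const)
    refine h l ⟨hl, fun ω => max 0 (min (l ω) 1), ⟨⟨hRm, 1, zero_le_one, fun ω => ?_⟩,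
      ⟨0, N.zero_mem, fun ω => ?_⟩, fun hR => hne ?_⟩, ?_⟩
    · rw [abs_of_nonneg (le_max_left _ _), one_mul]
      exact (max_le zero_le_one (min_le_right _ _)).trans (hL ω)
    · simp
    · filter_upwards [hR.eventuallyLE hN] with ω hω
      have h1 : min (l ω) 1 ≤ 0 := (le_max_right _ _).trans hω
      rcases min_le_iff.mp h1 with h2 | h2
      · exact h2
      · exact absurd h2 (by norm_num)
    · refine ordLE_of_eventuallyLE hN hRm (hI l hl) ?_
      filter_upwards [h0] with ω hω
      exact max_le hω (min_le_left _ _)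
  · rintro h l ⟨hl, R, ⟨hR, hR0, hRn⟩, hRl⟩
    have h1 : R ≤ᶠ[negligibleFilter hN] l := OrdLE.eventuallyLE hN hRl
    exact hRn (ordLE_of_eventuallyLE hN hR.1 measurable_const
      (h1.trans (h l hl ((hR0.eventuallyLE hN).trans h1))))

theorem stronglyFreeOfArbitrage_mono {J : Set (Ω → ℝ)} (hIJ : I ⊆ J)
    (h : (growthMarket L N J).StronglyFreeOfArbitrage) :
    (growthMarket L N I).StronglyFreeOfArbitrage :=
  fun l ⟨hl, hR⟩ => h l ⟨fun n => hIJ (hl n), hR⟩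

theorem noArbitrage_of_stronglyFree (h : (growthMarket L N I).StronglyFreeOfArbitrage) :
    (growthMarket L N I).NoArbitrage := by
  rintro l ⟨hl, R, hR, hRl⟩
  refine h (fun _ => l) ⟨fun _ => hl, R, hR, _, isVanishing_zero L N I, fun _ => ?_⟩
  simpa using hRl

/-- A limit of prices of super-replication up to vanishing claims is a price of exact
super-replication, if the dominated claims are Fatou closed. -/
theorem exists_superReplication (hN : IsNegligibleClass N) (hL : ∀ ω, 1 ≤ L ω)
    (hF : IsFatouClosed (negligibleFilter hN) I) {X : Ω → ℝ} {e l : ℕ → Ω → ℝ} {d : ℝ}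
    (hl : ∀ n, l n ∈ I) (he : (growthMarket L N I).IsVanishing e)
    (h : ∀ n, OrdLE N X fun ω => d + e n ω + l n ω) :
    ∃ k ∈ I, X ≤ᶠ[negligibleFilter hN] fun ω => d + k ω := by
  obtain ⟨k, hk, hXk⟩ := hF (fun n ω => X ω - d - e n ω) l (fun ω => X ω - d) hl (fun n => by
    filter_upwards [(h n).eventuallyLE hN] with ω hω
    linarith) (Eventually.of_forall fun ω => by
    simpa using (tendsto_of_isVanishing hL he ω).const_sub (X ω - d))
  refine ⟨k, hk, ?_⟩
  filter_upwards [hXk] with ω hω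
  linarith

theorem stronglyFree_of_isFatouClosed (hN : IsNegligibleClass N) (hL : ∀ ω, 1 ≤ L ω)
    (hI : ∀ l ∈ I, Measurable l) (hF : IsFatouClosed (negligibleFilter hN) I)
    (h : (growthMarket L N I).NoArbitrage) : (growthMarket L N I).StronglyFreeOfArbitrage := by
  rintro l ⟨hl, R, hR, e, he, hRl⟩
  obtain ⟨k, hk, hRk⟩ := exists_superReplication (d := 0) hN hL hF hl he
    (fun n => by
      have : OrdLE N R fun ω => e n ω + l n ω := hRl n
      simpa only [zero_add] using this)
  refine h k ⟨hk, R, hR, ordLE_of_eventuallyLE hN hR.1.1 (hI k hk) ?_⟩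
  simpa only [zero_add] using hRk

theorem attainment_of_isFatouClosed (hN : IsNegligibleClass N) (hL : ∀ ω, 1 ≤ L ω)
    (hI : ∀ l ∈ I, Measurable l) (hF : IsFatouClosed (negligibleFilter hN) I)
    (hmul : ∀ a : ℝ, ∀ l ∈ I, (fun ω => a * l ω) ∈ I)
    (hc : ∃ c : ℝ, (fun ω => L ω - c) ∈ I)
    (h : (growthMarket L N I).NoArbitrage) : (growthMarket L N I).Attainment := by
  intro X hX
  have hX' : Measurable X ∧ ∃ a : ℝ, 0 ≤ a ∧ ∀ ω, |X ω| ≤ a * L ω := hX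
  obtain ⟨hXm, a, -, hXa⟩ := hX'
  obtain ⟨c, hc⟩ := hc
  set P : Set ℝ := {d | (growthMarket L N I).SuperReplicates d X} with hP
  have hPd : ∀ d, d ∈ P ↔ ∃ k ∈ I, X ≤ᶠ[negligibleFilter hN] fun ω => d + k ω := by
    intro d
    constructor
    · rintro ⟨l, e, hl, he, hle⟩
      exact exists_superReplication hN hL hF hl he hle
    · rintro ⟨k, hk, hXk⟩
      refine ⟨fun _ => k, fun _ _ => 0, fun _ => hk, isVanishing_zero L N I, fun _ => ?_⟩
      simp only [add_zero]
      exact ordLE_of_eventuallyLE hN hXm (measurable_const.add (hI k hk)) hXk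
  have hne : P.Nonempty := by
    -- Since `X ≤ a * L = a * c + a * (L - c)`, holding `a` units of the trade `L - c`
    -- super-replicates.
    refine ⟨a * c, (hPd _).mpr ⟨_, hmul a _ hc, Eventually.of_forall fun ω => ?_⟩⟩
    have := (le_abs_self _).trans (hXa ω)
    simp only
    linarith
  have hbdd : BddBelow P := by
    by_contra hnb
    have hlow : ∀ n : ℕ, ∃ d ∈ P, d < -((n : ℝ) + 1) := fun n => by
      by_contra! hcon
      exact hnb ⟨_, fun d hd => hcon d hd⟩
    choose d hd hdn using hlow
    choose k hk hXk using fun n => (hPd (d n)).mp (hd n)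
    -- Prices below `-(n + 1)`, rescaled by `1 / (n + 1)`, let trades dominate `X / (n + 1) + 1`; in
    -- the limit a trade dominates `1`, an arbitrage.
    obtain ⟨l, hl, h1l⟩ := hF (fun n ω => (1 / ((n : ℝ) + 1)) * X ω + 1)
      (fun n ω => (1 / ((n : ℝ) + 1)) * k n ω) (fun _ => 1) (fun n => hmul _ _ (hk n))
      (fun n => by
        filter_upwards [hXk n] with ω hω
        have hpos : (0 : ℝ) < (n : ℝ) + 1 := by positivity
        have h1 : X ω + (n + 1) ≤ k n ω := by linarith [hdn n]
        have h2 := mul_le_mul_of_nonneg_left h1 (one_div_pos.mpr hpos).le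
        rwa [mul_add, one_div_mul_cancel hpos.ne'] at h2)
      (Eventually.of_forall fun ω => by
        simpa using (tendsto_one_div_add_atTop_nhds_zero_nat (𝕜 := ℝ)).mul_const (X ω)
          |>.add_const 1)
    refine h l ⟨hl, fun _ => 1, ⟨⟨measurable_const, 1, zero_le_one, fun ω => ?_⟩,
      ⟨0, N.zero_mem, fun ω => by simp⟩, not_one_ordLE_zero hN⟩,
      ordLE_of_eventuallyLE hN measurable_const (hI l hl) h1l⟩
    simpa using hL ω
  refine ⟨sInf P, ?_, ?_⟩
  · refine IsGLB.sInf_eq ⟨?_, ?_⟩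
    · rintro _ ⟨d, rfl, hd⟩
      exact EReal.coe_le_coe_iff.mpr (csInf_le hbdd hd)
    · intro x hx
      have hx' : ∀ d ∈ P, x ≤ (d : EReal) := fun d hd => hx ⟨d, rfl, hd⟩
      induction x with
      | bot => exact bot_le
      | top =>
        obtain ⟨d, hd⟩ := hne
        exact absurd (top_le_iff.mp (hx' d hd)) (EReal.coe_ne_top d)
      | coe x =>
        exact EReal.coe_le_coe_iff.mpr (le_csInf hne fun d hd =>
          EReal.coe_le_coe_iff.mp (hx' d hd))
  · obtain ⟨d, -, hdlim, hdP⟩ := exists_seq_tendsto_sInf hne hbdd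
    choose k hk hXk using fun n => (hPd (d n)).mp (hdP n)
    obtain ⟨l, hl, hXl⟩ := hF (fun n ω => X ω - d n) k (fun ω => X ω - sInf P) hk
      (fun n => by
        filter_upwards [hXk n] with ω hω
        linarith)
      (Eventually.of_forall fun ω => hdlim.const_sub (X ω))
    refine ⟨l, hl, ordLE_of_eventuallyLE hN hXm (measurable_const.add (hI l hl)) ?_⟩
    filter_upwards [hXl] with ω hω
    linarith

end GrowthMarket

/-! ### Gains of strategies and reduction to one period -/

section Gains

theorem measurable_fin_pi_iff {Ω : Type*} {G : MeasurableSpace Ω} {M : ℕ} {H : Ω → Fin M → ℝ} :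
    Measurable H ↔ ∀ i, Measurable fun ω => H ω i :=
  measurable_pi_iff

theorem measurable_scaled {Ω : Type*} {G : MeasurableSpace Ω} {M : ℕ} {H : Ω → Fin M → ℝ}
    (hH : Measurable H) : Measurable fun ω i => (1 + ∑ j, |H ω j|)⁻¹ * H ω i := by
  have hHi := measurable_fin_pi_iff.mp hH
  exact measurable_fin_pi_iff.mpr fun i => (measurable_const.add
    (Finset.measurable_sum _ fun j _ => (hHi j).abs)).inv.mul (hHi i)

theorem measurable_sum_mul_increment {Ω : Type*} {G : MeasurableSpace Ω} {M : ℕ}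
    {S : ℕ → Ω → Fin M → ℝ} {t : ℕ} {H : Ω → Fin M → ℝ}
    (hH : Measurable H) (h1 : Measurable (S (t + 1))) (h0 : Measurable (S t)) :
    Measurable fun ω => ∑ i, H ω i * (S (t + 1) ω i - S t ω i) :=
  Finset.measurable_sum _ fun i _ => ((measurable_fin_pi_iff.mp hH) i).mul
    (((measurable_fin_pi_iff.mp h1) i).sub ((measurable_fin_pi_iff.mp h0) i))

variable {Ω : Type*} [m : MeasurableSpace Ω] {M : ℕ} {𝓕 : Filtration ℕ m}
  {S : ℕ → Ω → Fin M → ℝ} {T : ℕ}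

theorem measurable_gains (hS : ∀ t ≤ T, Measurable[𝓕 t] (S t)) {H : ℕ → Ω → Fin M → ℝ}
    (hH : IsPredictable 𝓕 T H) : Measurable[𝓕 T] (gains S T H) :=
  Finset.measurable_sum _ fun t ht => by
    have ht := Finset.mem_range.mp ht
    exact measurable_sum_mul_increment ((hH t ht).mono (𝓕.mono ht.le) le_rfl)
      ((hS (t + 1) ht).mono (𝓕.mono ht) le_rfl) ((hS t ht.le).mono (𝓕.mono ht.le) le_rfl)

theorem measurable_of_mem_netTrades (hS : ∀ t ≤ T, Measurable[𝓕 t] (S t)) {l : Ω → ℝ}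
    (hl : l ∈ netTrades 𝓕 S T) : Measurable l := by
  obtain ⟨H, hH, rfl⟩ := hl
  exact (measurable_gains hS hH).mono (𝓕.le T) le_rfl

theorem boundedNetTrades_subset (𝓕 : Filtration ℕ m) (S : ℕ → Ω → Fin M → ℝ) (T : ℕ) :
    boundedNetTrades 𝓕 S T ⊆ netTrades 𝓕 S T := fun _ ⟨H, hH, _, hl⟩ => ⟨H, hH, hl⟩

theorem netTrades_eq_scalarTrades (𝓕 : Filtration ℕ m) (S : ℕ → Ω → Fin M → ℝ) (T : ℕ) :
    netTrades 𝓕 S T = scalarTrades 𝓕 (fun p : ℕ × Fin M => p.1)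
      (fun p ω => S (p.1 + 1) ω p.2 - S p.1 ω p.2) (Finset.range T ×ˢ Finset.univ) := by
  ext l
  constructor
  · rintro ⟨H, hH, rfl⟩
    refine ⟨fun p ω => H (p.1 + 1) ω p.2, fun p hp => ?_, ?_⟩
    · have hp := Finset.mem_range.mp (Finset.mem_product.mp hp).1
      exact (measurable_fin_pi_iff.mp (hH p.1 hp)) p.2
    · ext ω
      rw [Finset.sum_product]
      rfl
  · rintro ⟨h, hh, rfl⟩
    refine ⟨fun t ω i => h (t - 1, i) ω, fun t ht => ?_, ?_⟩
    · refine measurable_fin_pi_iff.mpr fun i => ?_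
      exact hh (t, i) (Finset.mem_product.mpr ⟨Finset.mem_range.mpr ht, Finset.mem_univ i⟩)
    · ext ω
      rw [Finset.sum_product]
      rfl

theorem mul_mem_netTrades (a : ℝ) {l : Ω → ℝ} (hl : l ∈ netTrades 𝓕 S T) :
    (fun ω => a * l ω) ∈ netTrades 𝓕 S T := by
  obtain ⟨H, hH, rfl⟩ := hl
  refine ⟨fun t ω i => a * H t ω i, fun t ht => measurable_fin_pi_iff.mpr fun i =>
    ((measurable_fin_pi_iff.mp (hH t ht)) i).const_mul a, ?_⟩
  ext ω
  simp only [gains, Finset.mul_sum, mul_assoc]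

/-- The increment from `t` to `t + 1` occurs in `a k - a 0` exactly for `k = t + 1, …, T`, that is,
`T - t` times. -/
theorem sum_mul_increment_eq (a : ℕ → ℝ) (T : ℕ) :
    ∑ t ∈ Finset.range T, ((T : ℝ) - t) * (a (t + 1) - a t) =
      ∑ k ∈ Finset.Icc 1 T, (a k - a 0) := by
  induction T with
  | zero => simp
  | succ T ih =>
    rw [Finset.sum_Icc_succ_top (by omega), ← ih, ← Finset.sum_range_sub a (T + 1),
      Finset.sum_range_succ, Finset.sum_range_succ _ T, ← add_assoc, ← Finset.sum_add_distrib]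
    congr 1
    · refine Finset.sum_congr rfl fun t _ => ?_
      push_cast
      ring
    · push_cast
      ring

theorem weight_sub_mem_netTrades (𝓕 : Filtration ℕ m) (S : ℕ → Ω → Fin M → ℝ) (T : ℕ) (c : ℝ) :
    (fun ω => weight S T c ω - c) ∈ netTrades 𝓕 S T := by
  -- The position at index `t + 1` is the deterministic number `T - t` in every asset.
  refine ⟨fun t _ _ => (T : ℝ) - ((t - 1 : ℕ) : ℝ), fun t _ => measurable_const, ?_⟩
  ext ω
  simp only [weight, gains, add_sub_cancel_left, Nat.add_sub_cancel]
  rw [Finset.sum_comm, Finset.sum_comm (s := Finset.range T)]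
  exact Finset.sum_congr rfl fun i _ => (sum_mul_increment_eq (fun t => S t ω i) T).symm

/-- A one-period gain, with positions scaled to be bounded, is a gain of a bounded strategy. -/
theorem exists_bounded_one_period {t : ℕ} (ht : t < T) {H : Ω → Fin M → ℝ}
    (hH : Measurable[𝓕 t] H) : ∃ u : Ω → ℝ, (∀ ω, 0 < u ω) ∧
      (fun ω => u ω * ∑ i, H ω i * (S (t + 1) ω i - S t ω i)) ∈ boundedNetTrades 𝓕 S T := by
  have hpos : ∀ ω, 0 < 1 + ∑ i, |H ω i| := fun ω => by positivity
  have hle : ∀ ω i, |(1 + ∑ i, |H ω i|)⁻¹ * H ω i| ≤ 1 := fun ω i => by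
    rw [abs_mul, abs_of_pos (inv_pos.mpr (hpos ω)), inv_mul_le_iff₀ (hpos ω), mul_one]
    have := Finset.single_le_sum (f := fun i => |H ω i|) (fun _ _ => abs_nonneg _)
      (Finset.mem_univ i)
    linarith
  refine ⟨fun ω => (1 + ∑ i, |H ω i|)⁻¹, fun ω => inv_pos.mpr (hpos ω),
    fun s ω i => if s = t + 1 then (1 + ∑ i, |H ω i|)⁻¹ * H ω i else 0, fun s _ => ?_,
    ⟨1, fun s _ ω i => ?_⟩, ?_⟩
  · by_cases hs : s = t
    · subst hs
      simp only [if_true]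
      exact measurable_scaled hH
    · simp only [add_left_inj, hs, if_false]
      exact measurable_const
  · beta_reduce
    split_ifs
    · exact hle ω i
    · rw [abs_zero]
      exact zero_le_one
  · ext ω
    rw [gains, Finset.sum_eq_single_of_mem t (Finset.mem_range.mpr ht)]
    · simp only [if_true, Finset.mul_sum, mul_assoc]
    · intro s _ hs
      simp [hs]

/-- If no one-period gain is an arbitrage, then no gain over several periods is. -/
theorem gains_le_zero_of_one_period {F : Filter Ω}
    (hS : ∀ t ≤ T, Measurable[𝓕 t] (S t))
    (h : ∀ t < T, ∀ H : Ω → Fin M → ℝ, Measurable[𝓕 t] H →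
      (0 ≤ᶠ[F] fun ω => ∑ i, H ω i * (S (t + 1) ω i - S t ω i)) →
      (fun ω => ∑ i, H ω i * (S (t + 1) ω i - S t ω i)) ≤ᶠ[F] 0)
    {n : ℕ} (hn : n ≤ T) {H : ℕ → Ω → Fin M → ℝ} (hH : IsPredictable 𝓕 n H)
    (h0 : 0 ≤ᶠ[F] gains S n H) : gains S n H ≤ᶠ[F] 0 := by
  classical
  induction n with
  | zero => exact Eventually.of_forall fun ω => by simp [gains]
  | succ n ih =>
    have hHn : IsPredictable 𝓕 n H := fun t ht => hH t (ht.trans n.lt_succ_self)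
    have hsucc : ∀ ω, gains S (n + 1) H ω =
        gains S n H ω + ∑ i, H (n + 1) ω i * (S (n + 1) ω i - S n ω i) := fun ω =>
      Finset.sum_range_succ _ _
    have hVm : Measurable[𝓕 n] (gains S n H) :=
      measurable_gains (fun t ht => hS t (ht.trans (Nat.le_of_succ_le hn))) hHn
    -- Where the gain up to time `n` is negative, the last period must recover the loss. Trading
    -- only there is a one-period gain that is nonnegative, so that event is negligible.
    set u : Ω → ℝ := fun ω => if gains S n H ω < 0 then 1 else 0 with hu
    have hum : Measurable[𝓕 n] u :=
      Measurable.ite (hVm measurableSet_Iio) measurable_const measurable_const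
    have husum : ∀ ω, ∑ i, (u ω * H (n + 1) ω i) * (S (n + 1) ω i - S n ω i) =
        u ω * ∑ i, H (n + 1) ω i * (S (n + 1) ω i - S n ω i) := fun ω => by
      simp only [Finset.mul_sum, mul_assoc]
    have hneg := h n hn (fun ω i => u ω * H (n + 1) ω i)
      (measurable_fin_pi_iff.mpr fun i =>
        hum.mul (measurable_fin_pi_iff.mp (hH n n.lt_succ_self) i))
      (by
        filter_upwards [h0] with ω hω
        rw [hsucc] at hω
        simp only [husum, Pi.zero_apply] at hω ⊢
        simp only [hu]
        split_ifs
        · linarith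
        · simp)
    have hV : 0 ≤ᶠ[F] gains S n H := by
      filter_upwards [h0, hneg] with ω h1 h2
      rw [hsucc] at h1
      simp only [husum, Pi.zero_apply] at h1 h2 ⊢
      by_contra! hlt
      simp only [hu, if_pos hlt] at h2
      linarith
    have hV' := ih (Nat.le_of_succ_le hn) hHn hV
    have hlast := h n hn (H (n + 1)) (hH n n.lt_succ_self) (by
      filter_upwards [h0, hV'] with ω h1 h2
      rw [hsucc] at h1
      simp only [Pi.zero_apply] at h1 h2 ⊢
      linarith)
    filter_upwards [hV', hlast] with ω h1 h2
    rw [hsucc]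
    simp only [Pi.zero_apply] at h1 h2 ⊢
    linarith

end Gains

/-- One-period arbitrages survive multiplication by a positive factor known at the start of the
period, so bounded positions already exclude them all. -/
theorem noArbitrage_of_bounded {Ω : Type*} [m : MeasurableSpace Ω] {M : ℕ} {𝓕 : Filtration ℕ m}
    {S : ℕ → Ω → Fin M → ℝ} {T : ℕ} {N : Submodule ℝ (Ω → ℝ)} {L : Ω → ℝ}
    (hN : IsNegligibleClass N) (hL : ∀ ω, 1 ≤ L ω) (hS : ∀ t ≤ T, Measurable[𝓕 t] (S t))
    (h : (growthMarket L N (boundedNetTrades 𝓕 S T)).NoArbitrage) :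
    (growthMarket L N (netTrades 𝓕 S T)).NoArbitrage := by
  rw [noArbitrage_iff hN hL fun l hl =>
    measurable_of_mem_netTrades hS (boundedNetTrades_subset 𝓕 S T hl)] at h
  rw [noArbitrage_iff hN hL fun l hl => measurable_of_mem_netTrades hS hl]
  rintro _ ⟨H, hH, rfl⟩ h0
  refine gains_le_zero_of_one_period hS (fun t ht H hH hnn => ?_) le_rfl hH h0
  obtain ⟨u, hu, hmem⟩ := exists_bounded_one_period (S := S) ht hH
  have hle := h _ hmem (by
    filter_upwards [hnn] with ω hω
    exact mul_nonneg (hu ω).le hω)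
  filter_upwards [hle] with ω hω
  exact nonpos_of_mul_nonpos_right hω (hu ω)

theorem isFatouClosed_netTrades {Ω : Type*} [m : MeasurableSpace Ω] {M : ℕ} {𝓕 : Filtration ℕ m}
    {S : ℕ → Ω → Fin M → ℝ} {T : ℕ} {N : Submodule ℝ (Ω → ℝ)} {L : Ω → ℝ}
    (hN : IsNegligibleClass N) (hL : ∀ ω, 1 ≤ L ω) (hS : ∀ t ≤ T, Measurable[𝓕 t] (S t))
    (h : (growthMarket L N (netTrades 𝓕 S T)).NoArbitrage) :
    IsFatouClosed (negligibleFilter hN) (netTrades 𝓕 S T) := by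
  rw [noArbitrage_iff hN hL fun l hl => measurable_of_mem_netTrades hS hl] at h
  rw [netTrades_eq_scalarTrades] at h ⊢
  exact isFatouClosed_scalarTrades 𝓕 _ _ _ h

end KnightianMarket

theorem theoremt {Ω : Type*} [m : MeasurableSpace Ω] (T M : ℕ) (𝓕 : Filtration ℕ m)
    (S : ℕ → Ω → Fin M → ℝ)
    (hS_adapted : ∀ t ≤ T, Measurable[𝓕 t] (S t))
    (hS_nonneg : ∀ t ≤ T, ∀ ω i, 0 ≤ S t ω i)
    (c : ℝ) (hc : 0 < c) (hL : ∀ ω, 1 ≤ KnightianMarket.weight S T c ω)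
    (N : Submodule ℝ (Ω → ℝ)) (hN : KnightianMarket.IsNegligibleClass N)
    (Θ Θb : KnightianMarket.Market Ω)
    (hΘ : Θ = KnightianMarket.growthMarket (KnightianMarket.weight S T c) N
      (KnightianMarket.netTrades 𝓕 S T))
    (hΘb : Θb = KnightianMarket.growthMarket (KnightianMarket.weight S T c) N
      (KnightianMarket.boundedNetTrades 𝓕 S T)) :
    List.TFAE [Θ.NoArbitrage, Θ.Attainment ∧ Θ.NoArbitrage, Θ.StronglyFreeOfArbitrage] ∧
      List.TFAE [Θ.NoArbitrage, Θb.NoArbitrage, Θb.StronglyFreeOfArbitrage] := by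
  subst hΘ hΘb
  have hmeas : ∀ l ∈ KnightianMarket.netTrades 𝓕 S T, Measurable l := fun l hl =>
    KnightianMarket.measurable_of_mem_netTrades hS_adapted hl
  have hsub := KnightianMarket.boundedNetTrades_subset 𝓕 S T
  have hstrong := fun h => KnightianMarket.stronglyFree_of_isFatouClosed hN hL hmeas
    (KnightianMarket.isFatouClosed_netTrades hN hL hS_adapted h) h
  constructor
  · tfae_have 1 → 2 := fun h => ⟨KnightianMarket.attainment_of_isFatouClosed hN hL hmeas
      (KnightianMarket.isFatouClosed_netTrades hN hL hS_adapted h)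
      (fun a _ hl => KnightianMarket.mul_mem_netTrades a hl)
      ⟨c, KnightianMarket.weight_sub_mem_netTrades 𝓕 S T c⟩ h, h⟩
    tfae_have 2 → 1 := fun h => h.2
    tfae_have 1 → 3 := hstrong
    tfae_have 3 → 1 := KnightianMarket.noArbitrage_of_stronglyFree
    tfae_finish
  · tfae_have 1 → 3 := fun h => KnightianMarket.stronglyFreeOfArbitrage_mono hsub (hstrong h)
    tfae_have 3 → 2 := KnightianMarket.noArbitrage_of_stronglyFree
    tfae_have 2 → 1 := KnightianMarket.noArbitrage_of_bounded hN hL hS_adapted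
    tfae_finish
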